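/- There exist universal constants $C, c > 0$ such that for every $n$, every Boolean function $f:\{-1,1\}^n\to\{-1,1\}$ and every $\varepsilon\in[0,1]$, $$S_\varepsilon(f)\;\le\; C\cdot \mathrm{Var}(f)\left(\sum_{i=1}^n \mathrm{Inf}_i(f)^2\right)^{c\varepsilon}.$$ Here $\mu$ is the uniform probability measure on $\{-1,1\}^n$; $\mathrm{Var}(f)=\mathbb{E}_\mu (f-\mathbb{E}_\mu f)^2$; $\mathrm{Inf}_i(f)=\mu(\{y : f(y)\ne f(y^{\oplus i})\})$, where $y^{\oplus i}$ is $y$ with its $i$-th bit flipped; and $S_\varepsilon(f)=\mathrm{Cov}[f(x),f(y)]$ is the noise stability of $f$, where $x\sim\mu$ and, given $x$, the coordinates of $y$ are independent, $y_i$ being equal to $x_i$ with probability $1-\varepsilon$ and to a uniformly random bit with probability $\varepsilon$. (The convention $0^0=1$ is used.) -/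

import Mathlib

open scoped BigOperators

namespace BooleanCube

/-- The discrete hypercube `{-1,1}^n`; `ℤˣ` is the two-element set `{1, -1}`. -/
abbrev Cube (n : ℕ) : Type := Fin n → ℤˣ

/-- The expectation of `h` under the uniform probability measure on the hypercube. -/
noncomputable def expect {n : ℕ} (h : Cube n → ℝ) : ℝ :=
  (∑ y : Cube n, h y) / 2 ^ n

/-- The uniform probability measure of a set of points of the hypercube. -/
noncomputable def unifProb {n : ℕ} (A : Set (Cube n)) : ℝ :=
  (A.ncard : ℝ) / 2 ^ n

/-- A Boolean function, read as a real-valued function with values in `{-1, 1}`. -/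
def toReal {n : ℕ} (f : Cube n → ℤˣ) (y : Cube n) : ℝ := ((f y : ℤ) : ℝ)

/-- The point `y` with the `i`-th bit flipped. -/
def flip {n : ℕ} (y : Cube n) (i : Fin n) : Cube n := Function.update y i (-(y i))

/-- The influence of the `i`-th coordinate: the probability that flipping the `i`-th bit
of a uniform point changes the value of `f`. -/
noncomputable def influence {n : ℕ} (f : Cube n → ℤˣ) (i : Fin n) : ℝ :=
  unifProb {y : Cube n | f y ≠ f (flip y i)}

/-- The variance `E (f - E f)^2` under the uniform measure. -/
noncomputable def variance {n : ℕ} (f : Cube n → ℤˣ) : ℝ :=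
  expect fun y => (toReal f y - expect (toReal f)) ^ 2

/-- The law of the random vector `N_ε(x)`: `noise ε x y` is the probability that it equals `y`.
The coordinates are independent, the `i`-th one being equal to `x i` with
probability `1 - ε` and to a uniformly random bit with probability `ε`. -/
noncomputable def noise {n : ℕ} (ε : ℝ) (x y : Cube n) : ℝ :=
  ∏ i, ((1 - ε) * (if y i = x i then 1 else 0) + ε * (1 / 2))

/-- The expectation of `h (x, y)` where `x` is uniform on the hypercube and, given `x`,
the vector `y` is distributed as `N_ε(x)`. -/
noncomputable def noiseExpect {n : ℕ} (ε : ℝ) (h : Cube n → Cube n → ℝ) : ℝ :=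
  expect fun x => ∑ y : Cube n, noise ε x y * h x y

/-- The noise stability `S_ε(f)`: the covariance of `f(x)` and `f(y)` where `x` is uniform
on the hypercube and `y` is distributed as `N_ε(x)`. -/
noncomputable def noiseStability {n : ℕ} (ε : ℝ) (f : Cube n → ℤˣ) : ℝ :=
  noiseExpect ε fun x y =>
    (toReal f x - noiseExpect ε fun x' _ => toReal f x') *
      (toReal f y - noiseExpect ε fun _ y' => toReal f y')

end BooleanCube

namespace BooleanCube

/-! In Fourier terms the stability is the sum of `(1 - ε)^|S|` times the squared coefficients, so it
suffices to treat one fixed noise level and interpolate. The level used damps `S` by `8⁻¹ ^ |S|`.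
With `V` the variance and `W` the sum of squared influences, the damped weight is at most both `V *
√V` and `√W * √V`; their geometric mean is `V * W^(1/4)`.

Both bounds rest on `‖T v‖₂² ≤ ‖v‖₁ ‖v‖₂` for noise of correlation `1/2` (`expect_noiseOp_sq_le`), a
consequence of (2,4)-hypercontractivity. The first takes `v = f - E f`. The second fixes a set `J`
and, for `i ∈ J`, takes the part `v i` of `f` with frequencies `S ∩ J = {i}`: its `L¹` norm is at
most the influence of `i`, and these parts are orthogonal, so Cauchy–Schwarz applies. Averaging over
`J` captures each nonempty `S` at the price of a factor `2^|S|`. -/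

variable {n : ℕ}

/-! ### Signs, characters and noise operators -/

/-- A sign, read as a real number. -/
def sgn (s : ℤˣ) : ℝ := ((s : ℤ) : ℝ)

@[simp] lemma sgn_one : sgn 1 = 1 := by simp [sgn]

@[simp] lemma sgn_neg (s : ℤˣ) : sgn (-s) = -sgn s := by simp [sgn]

lemma sgn_mul_self (s : ℤˣ) : sgn s * sgn s = 1 := by
  rcases Int.units_eq_one_or s with rfl | rfl <;> simp

lemma sum_signs (φ : ℤˣ → ℝ) : ∑ s, φ s = φ 1 + φ (-1) := by
  rw [UnitsInt.univ, Finset.sum_pair (by decide)]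

/-- The Walsh character of a set of coordinates. -/
def walsh (S : Finset (Fin n)) (x : Cube n) : ℝ := ∏ i ∈ S, sgn (x i)

/-- The Fourier–Walsh coefficient of a function on the hypercube. -/
noncomputable def fourier (h : Cube n → ℝ) (S : Finset (Fin n)) : ℝ :=
  expect fun x => h x * walsh S x

/-- The kernel of the noise operator with correlation `q i` in the `i`-th coordinate. -/
def kernel (q : Fin n → ℝ) (x y : Cube n) : ℝ := ∏ i, (1 + q i * (sgn (x i) * sgn (y i)))

/-- The noise operator with correlation `q i` in the `i`-th coordinate. -/
noncomputable def noiseOp (q : Fin n → ℝ) (h : Cube n → ℝ) (x : Cube n) : ℝ :=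
  expect fun y => kernel q x y * h y

/-! ### Expectations -/

lemma expect_add (g h : Cube n → ℝ) :
    expect (fun x => g x + h x) = expect g + expect h := by
  simp only [expect, Finset.sum_add_distrib, add_div]

lemma expect_sub (g h : Cube n → ℝ) :
    expect (fun x => g x - h x) = expect g - expect h := by
  simp only [expect, Finset.sum_sub_distrib, sub_div]

lemma expect_const_mul (a : ℝ) (h : Cube n → ℝ) :
    expect (fun x => a * h x) = a * expect h := by
  simp only [expect, ← Finset.mul_sum, mul_div_assoc]

lemma expect_const (a : ℝ) : expect (fun _ : Cube n => a) = a := by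
  simp [expect]

lemma expect_mono {g h : Cube n → ℝ} (hgh : ∀ x, g x ≤ h x) : expect g ≤ expect h := by
  unfold expect
  gcongr
  exact hgh _

lemma expect_nonneg {h : Cube n → ℝ} (hh : ∀ x, 0 ≤ h x) : 0 ≤ expect h :=
  div_nonneg (Finset.sum_nonneg fun x _ => hh x) (by positivity)

lemma abs_expect_le (h : Cube n → ℝ) : |expect h| ≤ expect fun x => |h x| := by
  rw [expect, expect, abs_div, abs_of_pos (by positivity : (0 : ℝ) < 2 ^ n)]
  gcongr
  exact Finset.abs_sum_le_sum_abs _ _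

lemma expect_comm (F : Cube n → Cube n → ℝ) :
    (expect fun x => expect fun y => F x y) = expect fun y => expect fun x => F x y := by
  simp only [expect, ← Finset.sum_div]
  rw [Finset.sum_comm]

lemma expect_sum {ι : Type*} (s : Finset ι) (F : ι → Cube n → ℝ) :
    (expect fun x => ∑ i ∈ s, F i x) = ∑ i ∈ s, expect (F i) := by
  simp only [expect, ← Finset.sum_div]
  rw [Finset.sum_comm]

lemma expect_mul_sq_le (g h : Cube n → ℝ) :
    (expect fun x => g x * h x) ^ 2 ≤ (expect fun x => g x ^ 2) * expect fun x => h x ^ 2 := by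
  simp only [expect]
  rw [div_pow, div_mul_div_comm, ← sq]
  gcongr
  exact Finset.sum_mul_sq_le_sq_mul_sq _ _ _

lemma expect_prod (φ : Fin n → ℤˣ → ℝ) :
    (expect fun x => ∏ i, φ i (x i)) = ∏ i, (φ i 1 + φ i (-1)) / 2 := by
  rw [expect, Finset.prod_div_distrib]
  simp only [← sum_signs, Finset.prod_univ_sum, Fintype.piFinset_univ]
  simp

lemma expect_cons (h : Cube (n + 1) → ℝ) :
    expect h = expect fun x : Cube n => (h (Fin.cons 1 x) + h (Fin.cons (-1) x)) / 2 := by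
  rw [expect, expect, ← (Fin.consEquiv fun _ : Fin (n + 1) => ℤˣ).sum_comp, Fintype.sum_prod_type,
    sum_signs, ← Finset.sum_div, Finset.sum_add_distrib, pow_succ', div_div]
  rfl

/-! ### Fourier analysis -/

lemma walsh_eq_prod (S : Finset (Fin n)) (x : Cube n) :
    walsh S x = ∏ i, if i ∈ S then sgn (x i) else 1 := by
  simp [walsh]

lemma kernel_comm (q : Fin n → ℝ) (x y : Cube n) : kernel q x y = kernel q y x := by
  simp only [kernel, mul_comm (sgn (x _))]

lemma kernel_nonneg {q : Fin n → ℝ} (h0 : ∀ i, 0 ≤ q i) (h1 : ∀ i, q i ≤ 1) (x y : Cube n) :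
    0 ≤ kernel q x y := by
  refine Finset.prod_nonneg fun i _ => ?_
  rcases Int.units_eq_one_or (x i) with hx | hx <;>
    rcases Int.units_eq_one_or (y i) with hy | hy <;>
    simp only [hx, hy, sgn_neg, sgn_one] <;> linarith [h0 i, h1 i]

lemma expect_kernel (q : Fin n → ℝ) (x : Cube n) : expect (kernel q x) = 1 := by
  have := expect_prod fun i s => 1 + q i * (sgn (x i) * sgn s)
  simp only [sgn_one, sgn_neg] at this
  refine this.trans (Finset.prod_eq_one fun i _ => ?_)
  ring

lemma kernel_eq_sum (q : Fin n → ℝ) (x y : Cube n) :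
    kernel q x y = ∑ S : Finset (Fin n), (∏ i ∈ S, q i) * (walsh S x * walsh S y) := by
  simp only [kernel, Finset.prod_one_add, Finset.powerset_univ, walsh, Finset.prod_mul_distrib]

lemma kernel_one (x y : Cube n) : kernel (fun _ => 1) x y = if y = x then 2 ^ n else 0 := by
  split_ifs with h
  · subst h
    simp only [kernel, sgn_mul_self]
    norm_num
  · obtain ⟨i, hi⟩ := Function.ne_iff.1 h
    refine Finset.prod_eq_zero (Finset.mem_univ i) ?_
    rcases Int.units_eq_one_or (x i) with hx | hx <;>
      rcases Int.units_eq_one_or (y i) with hy | hy <;> simp_all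

lemma noiseOp_one (h : Cube n → ℝ) : noiseOp (fun _ => 1) h = h := by
  funext x
  simp [noiseOp, kernel_one, expect]

lemma expect_mul_noiseOp (q : Fin n → ℝ) (g h : Cube n → ℝ) :
    (expect fun x => g x * noiseOp q h x) =
      ∑ S : Finset (Fin n), (∏ i ∈ S, q i) * (fourier g S * fourier h S) := by
  have key : ∀ x, g x * noiseOp q h x =
      ∑ S : Finset (Fin n), (∏ i ∈ S, q i) * fourier h S * (g x * walsh S x) := by
    intro x
    rw [noiseOp]
    simp only [kernel_eq_sum, Finset.sum_mul]
    rw [expect_sum, Finset.mul_sum]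
    refine Finset.sum_congr rfl fun S _ => ?_
    have : (fun y => (∏ i ∈ S, q i) * (walsh S x * walsh S y) * h y) =
        fun y => ((∏ i ∈ S, q i) * walsh S x) * (h y * walsh S y) := by
      funext y; ring
    rw [this, expect_const_mul, ← fourier]
    ring
  simp only [key]
  rw [expect_sum]
  refine Finset.sum_congr rfl fun S _ => ?_
  rw [expect_const_mul, ← fourier]
  ring

/-- Correlation `1` makes the noise operator the identity. -/
lemma parseval (h : Cube n → ℝ) :
    (expect fun x => h x ^ 2) = ∑ S : Finset (Fin n), fourier h S ^ 2 := by
  have := expect_mul_noiseOp (fun _ => 1) h h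
  simpa [noiseOp_one, ← sq] using this

lemma expect_mul_noiseOp_comm (q : Fin n → ℝ) (g h : Cube n → ℝ) :
    (expect fun x => g x * noiseOp q h x) = expect fun x => noiseOp q g x * h x := by
  rw [expect_mul_noiseOp]
  simp only [mul_comm (noiseOp q g _)]
  rw [expect_mul_noiseOp]
  simp only [mul_comm (fourier g _)]

lemma noiseOp_walsh (q : Fin n → ℝ) (S : Finset (Fin n)) (x : Cube n) :
    noiseOp q (walsh S) x = (∏ i ∈ S, q i) * walsh S x := by
  have := expect_prod fun i s =>
    (1 + q i * (sgn (x i) * sgn s)) * if i ∈ S then sgn s else 1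
  simp only [Finset.prod_mul_distrib, sgn_one, sgn_neg] at this
  simp only [noiseOp, kernel, walsh_eq_prod]
  have hq : ∏ i ∈ S, q i = ∏ i, if i ∈ S then q i else 1 := by simp
  rw [this, hq, ← Finset.prod_mul_distrib]
  refine Finset.prod_congr rfl fun i _ => ?_
  split_ifs <;> ring

lemma fourier_noiseOp (q : Fin n → ℝ) (h : Cube n → ℝ) (S : Finset (Fin n)) :
    fourier (noiseOp q h) S = (∏ i ∈ S, q i) * fourier h S := by
  rw [fourier, ← expect_mul_noiseOp_comm, fourier, ← expect_const_mul]
  simp only [noiseOp_walsh]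
  congr 1; funext x; ring

/-- The kernel is nonnegative, symmetric and of mean one in each variable. -/
lemma expect_abs_noiseOp_le {q : Fin n → ℝ} (h0 : ∀ i, 0 ≤ q i) (h1 : ∀ i, q i ≤ 1)
    (h : Cube n → ℝ) : (expect fun x => |noiseOp q h x|) ≤ expect fun x => |h x| := by
  calc (expect fun x => |noiseOp q h x|)
      ≤ expect fun x => expect fun y => kernel q x y * |h y| := by
        refine expect_mono fun x => (abs_expect_le _).trans_eq ?_
        simp only [abs_mul, abs_of_nonneg (kernel_nonneg h0 h1 _ _)]
    _ = expect fun y => |h y| := by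
        rw [expect_comm]
        congr 1; funext y
        simp only [mul_comm _ |h y|]
        rw [expect_const_mul]
        simp only [kernel_comm q _ y]
        rw [expect_kernel, mul_one]

/-! ### Hypercontractivity -/

lemma noiseOp_cons (r : ℝ) (h : Cube (n + 1) → ℝ) (s : ℤˣ) (x : Cube n) :
    noiseOp (fun _ => r) h (Fin.cons s x) =
      noiseOp (fun _ => r) (fun y => (h (Fin.cons 1 y) + h (Fin.cons (-1) y)) / 2) x +
        r * sgn s *
          noiseOp (fun _ => r) (fun y => (h (Fin.cons 1 y) - h (Fin.cons (-1) y)) / 2) x := by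
  simp only [noiseOp]
  rw [expect_cons, ← expect_const_mul, ← expect_add]
  congr 1; funext y
  simp only [kernel, Fin.prod_univ_succ, Fin.cons_zero, Fin.cons_succ, sgn_one, sgn_neg]
  ring

/-- The `(2, 4)`-hypercontractive inequality. -/
theorem expect_noiseOp_pow_four_le (h : Cube n → ℝ) :
    (expect fun x => noiseOp (fun _ => 1 / 2) h x ^ 4) ≤ (expect fun x => h x ^ 2) ^ 2 := by
  induction n with
  | zero =>
    simp [noiseOp, kernel, expect]
    exact le_of_eq (by ring)
  | succ n ih =>
    set h₀ : Cube n → ℝ := fun y => (h (Fin.cons 1 y) + h (Fin.cons (-1) y)) / 2 with hh₀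
    set h₁ : Cube n → ℝ := fun y => (h (Fin.cons 1 y) - h (Fin.cons (-1) y)) / 2 with hh₁
    set a := noiseOp (fun _ => 1 / 2) h₀ with ha
    set b := noiseOp (fun _ => 1 / 2) h₁ with hb
    set A := expect fun x => h₀ x ^ 2 with hA
    set B := expect fun x => h₁ x ^ 2 with hB
    have hA0 : 0 ≤ A := expect_nonneg fun x => sq_nonneg _
    have hB0 : 0 ≤ B := expect_nonneg fun x => sq_nonneg _
    have e2 : (expect fun x => h x ^ 2) = A + B := by
      rw [expect_cons, hA, hB, ← expect_add]
      congr 1; funext x; simp only [hh₀, hh₁]; ring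
    -- Averaging `(a ± b/2)^4` over the sign kills the odd powers of `b`.
    have e4 : (expect fun x => noiseOp (fun _ => 1 / 2) h x ^ 4) =
        (expect fun x => a x ^ 4) + (3 / 2 * (expect fun x => a x ^ 2 * b x ^ 2) +
          1 / 16 * expect fun x => b x ^ 4) := by
      rw [expect_cons, ← expect_const_mul, ← expect_const_mul, ← expect_add, ← expect_add]
      congr 1; funext x
      simp only [noiseOp_cons, sgn_one, sgn_neg, ← hh₀, ← hh₁, ← ha, ← hb]
      ring
    have hab : (expect fun x => a x ^ 2 * b x ^ 2) ≤ A * B := by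
      refine abs_le_of_sq_le_sq' ?_ (by positivity) |>.2
      refine (expect_mul_sq_le _ _).trans ?_
      simp only [← pow_mul, mul_pow]
      exact mul_le_mul (ih h₀) (ih h₁) (expect_nonneg fun x => Even.pow_nonneg (by decide) (b x))
        (sq_nonneg A)
    rw [e2, e4]
    nlinarith [ih h₀, ih h₁, mul_nonneg hA0 hB0, sq_nonneg B]

/-- Noise smooths a function whose `L¹` norm is small compared with its `L²` norm. -/
theorem expect_noiseOp_sq_le (v : Cube n → ℝ) :
    (expect fun x => noiseOp (fun _ => 1 / 2) v x ^ 2) ≤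
      (expect fun x => |v x|) * √(expect fun x => v x ^ 2) := by
  set T : (Cube n → ℝ) → Cube n → ℝ := noiseOp fun _ => 1 / 2 with hT
  set u := T (T v)
  set R := expect fun x => T v x ^ 2
  set V := expect fun x => v x ^ 2
  set N := expect fun x => |v x|
  have hR0 : 0 ≤ R := expect_nonneg fun x => sq_nonneg _
  have hN0 : 0 ≤ N := expect_nonneg fun x => abs_nonneg _
  have hV0 : 0 ≤ V := expect_nonneg fun x => sq_nonneg _
  -- Self-adjointness of `T`, with `u = T (T v)`.
  have hRu : R = expect fun x => v x * u x := by
    rw [expect_mul_noiseOp_comm]; simp only [← hT, ← sq]; rfl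
  have h1 : R ^ 2 ≤ N * expect fun x => |v x| * u x ^ 2 := by
    have hle : R ≤ expect fun x => √|v x| * (√|v x| * |u x|) := by
      rw [hRu]
      refine expect_mono fun x => ?_
      rw [← mul_assoc, Real.mul_self_sqrt (abs_nonneg _), ← abs_mul]
      exact le_abs_self _
    refine (pow_le_pow_left₀ hR0 hle 2).trans ((expect_mul_sq_le _ _).trans_eq ?_)
    simp only [mul_pow, Real.sq_sqrt (abs_nonneg _), sq_abs, N]
  -- Cauchy–Schwarz leaves `‖u‖₄²`, which hypercontractivity for `T v` bounds by `R`.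
  have h2 : (expect fun x => |v x| * u x ^ 2) ≤ √V * R := by
    refine abs_le_of_sq_le_sq' ?_ (mul_nonneg (Real.sqrt_nonneg _) hR0) |>.2
    refine (expect_mul_sq_le _ _).trans ?_
    rw [mul_pow, Real.sq_sqrt hV0]
    simp only [sq_abs, ← pow_mul]
    exact mul_le_mul_of_nonneg_left (expect_noiseOp_pow_four_le (T v)) hV0
  rcases hR0.eq_or_lt with h | h
  · rw [← h]; exact mul_nonneg hN0 (Real.sqrt_nonneg _)
  · refine le_of_mul_le_mul_right ?_ h
    calc R * R = R ^ 2 := (sq R).symm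
      _ ≤ N * (√V * R) := h1.trans (mul_le_mul_of_nonneg_left h2 hN0)
      _ = N * √V * R := by ring

/-! ### Influences -/

/-- A Boolean function with its mean subtracted. -/
noncomputable def centered (f : Cube n → ℤˣ) (x : Cube n) : ℝ :=
  toReal f x - expect (toReal f)

/-- The part of a function that depends on the `i`-th coordinate. -/
noncomputable def laplacian (i : Fin n) (h : Cube n → ℝ) (x : Cube n) : ℝ :=
  (h x - h (flip x i)) / 2

lemma flip_flip (x : Cube n) (i : Fin n) : flip (flip x i) i = x := by
  simp [flip]

lemma expect_flip (h : Cube n → ℝ) (i : Fin n) : (expect fun x => h (flip x i)) = expect h := by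
  rw [expect, expect]
  congr 1
  exact Equiv.sum_comp
    (Function.Involutive.toPerm (fun x : Cube n => flip x i) fun x => flip_flip x i) h

lemma walsh_flip (S : Finset (Fin n)) (x : Cube n) (i : Fin n) :
    walsh S (flip x i) = (if i ∈ S then -1 else 1) * walsh S x := by
  have h : ∀ j, sgn (flip x i j) = (if j = i then -1 else 1) * sgn (x j) := by
    intro j
    by_cases hj : j = i
    · subst hj; simp [flip]
    · simp [flip, hj]
  simp only [walsh, h, Finset.prod_mul_distrib, Finset.prod_ite_eq']

lemma fourier_laplacian (i : Fin n) (h : Cube n → ℝ) (S : Finset (Fin n)) :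
    fourier (laplacian i h) S = if i ∈ S then fourier h S else 0 := by
  have e : fourier (fun x => h (flip x i)) S = (if i ∈ S then -1 else 1) * fourier h S := by
    rw [fourier, ← expect_flip _ i, fourier, ← expect_const_mul]
    simp only [flip_flip, walsh_flip]
    congr 1; funext x; ring
  have : fourier (laplacian i h) S =
      1 / 2 * (fourier h S - fourier (fun x => h (flip x i)) S) := by
    rw [fourier, fourier, fourier, ← expect_sub, ← expect_const_mul]
    congr 1; funext x; simp only [laplacian]; ring
  rw [this, e]
  split_ifs <;> ring

lemma toReal_sq (f : Cube n → ℤˣ) (x : Cube n) : toReal f x * toReal f x = 1 :=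
  sgn_mul_self (f x)

lemma expect_abs_laplacian (f : Cube n → ℤˣ) (i : Fin n) :
    (expect fun x => |laplacian i (centered f) x|) = influence f i := by
  classical
  rw [expect, influence, unifProb, Set.ncard_eq_toFinset_card', Set.toFinset_ofPred,
    Finset.card_filter]
  push_cast
  congr 1
  refine Finset.sum_congr rfl fun x _ => ?_
  simp only [laplacian, centered, toReal]
  rcases Int.units_eq_one_or (f x) with hx | hx <;>
    rcases Int.units_eq_one_or (f (flip x i)) with hy | hy <;> norm_num [hx, hy]

lemma variance_eq (f : Cube n → ℤˣ) : variance f = expect fun x => centered f x ^ 2 := rfl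

lemma variance_eq_one_sub (f : Cube n → ℤˣ) : variance f = 1 - expect (toReal f) ^ 2 := by
  set m := expect (toReal f) with hm
  have : ∀ x, centered f x ^ 2 = (1 + m ^ 2) - 2 * m * toReal f x := by
    intro x
    have := toReal_sq f x
    simp only [centered, ← hm]
    linear_combination this
  rw [variance_eq]
  simp only [this]
  rw [expect_sub, expect_const, expect_const_mul, ← hm]
  ring

lemma variance_nonneg (f : Cube n → ℤˣ) : 0 ≤ variance f := expect_nonneg fun _ => sq_nonneg _

/-- As `f = ±1` and its mean `m` satisfies `|m| ≤ 1`, one has `|f - m| = 1 - m f`, of mean `1 - m²`.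
-/
lemma expect_abs_centered (f : Cube n → ℤˣ) :
    (expect fun x => |centered f x|) = variance f := by
  set m := expect (toReal f) with hm
  have hm2 : m ^ 2 ≤ 1 := by
    have := variance_nonneg f
    rw [variance_eq_one_sub] at this
    linarith
  obtain ⟨h1, h2⟩ := abs_le.1 ((sq_le_one_iff_abs_le_one m).1 hm2)
  have : ∀ x, |centered f x| = 1 - m * toReal f x := by
    intro x
    simp only [centered, ← hm, toReal]
    rcases Int.units_eq_one_or (f x) with hx | hx
    · simp only [hx, Units.val_one, Int.cast_one]
      rw [abs_of_nonneg (by linarith)]; ring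
    · simp only [hx, Units.val_neg, Units.val_one, Int.cast_neg, Int.cast_one]
      rw [abs_of_nonpos (by linarith)]; ring
  simp only [this]
  rw [expect_sub, expect_const, expect_const_mul, ← hm, variance_eq_one_sub, ← hm]
  ring

lemma fourier_centered_empty (f : Cube n → ℤˣ) : fourier (centered f) ∅ = 0 := by
  simp only [fourier, walsh, Finset.prod_empty, mul_one, centered]
  rw [expect_sub, expect_const, sub_self]

lemma variance_eq_sum (f : Cube n → ℤˣ) :
    variance f = ∑ S : Finset (Fin n), fourier (centered f) S ^ 2 := parseval _

/-! ### Noise stability -/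

lemma noise_eq (ε : ℝ) (x y : Cube n) :
    noise ε x y = kernel (fun _ => 1 - ε) x y / 2 ^ n := by
  have : (2 : ℝ) ^ n = ∏ _i : Fin n, 2 := by simp
  rw [noise, kernel, this, ← Finset.prod_div_distrib]
  refine Finset.prod_congr rfl fun i _ => ?_
  rcases Int.units_eq_one_or (x i) with hx | hx <;>
    rcases Int.units_eq_one_or (y i) with hy | hy <;> simp [hx, hy] <;> ring

lemma noiseExpect_eq (ε : ℝ) (h : Cube n → Cube n → ℝ) :
    noiseExpect ε h = expect fun x => expect fun y => kernel (fun _ => 1 - ε) x y * h x y := by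
  simp only [noiseExpect, noise_eq]
  congr 1; funext x
  rw [expect, Finset.sum_div]
  exact Finset.sum_congr rfl fun y _ => by ring

lemma noiseStability_eq_sum (ε : ℝ) (f : Cube n → ℤˣ) :
    noiseStability ε f =
      ∑ S : Finset (Fin n), (1 - ε) ^ S.card * fourier (centered f) S ^ 2 := by
  have h1 : (noiseExpect ε fun x' _ => toReal f x') = expect (toReal f) := by
    rw [noiseExpect_eq]
    simp only [mul_comm _ (toReal f _), expect_const_mul]
    simp only [expect_kernel, mul_one]
  have h2 : (noiseExpect ε fun _ y' => toReal f y') = expect (toReal f) := by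
    rw [noiseExpect_eq, expect_comm]
    congr 1; funext y
    simp only [mul_comm _ (toReal f y), expect_const_mul, kernel_comm _ _ y]
    rw [expect_kernel, mul_one]
  rw [noiseStability, h1, h2, noiseExpect_eq]
  have := expect_mul_noiseOp (fun _ => 1 - ε) (centered f) (centered f)
  simp only [Finset.prod_const, ← sq] at this
  rw [← this]
  congr 1; funext x
  rw [noiseOp, ← expect_const_mul]
  congr 1; funext y
  simp only [centered]; ring

/-! ### The Fourier weight at constant noise -/

/-- The Fourier weight of a Boolean function, damped by `8⁻¹` per coordinate. -/
noncomputable def dampedWeight (f : Cube n → ℤˣ) : ℝ :=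
  ∑ S : Finset (Fin n), (1 / 8) ^ S.card * fourier (centered f) S ^ 2

lemma dampedWeight_nonneg (f : Cube n → ℤˣ) : 0 ≤ dampedWeight f :=
  Finset.sum_nonneg fun _ _ => by positivity

lemma dampedWeight_le_variance (f : Cube n → ℤˣ) :
    dampedWeight f ≤ variance f * √(variance f) := by
  have h := expect_noiseOp_sq_le (centered f)
  rw [expect_abs_centered, ← variance_eq, parseval] at h
  refine le_trans (Finset.sum_le_sum fun S _ => ?_) h
  rw [fourier_noiseOp, mul_pow, Finset.prod_const, ← pow_mul, mul_comm S.card 2, pow_mul]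
  gcongr
  norm_num

/-- The weight `1/4` per coordinate is the square of the correlation `1/2` in the smoothing bound.
-/
lemma sum_inter_eq_singleton_le (f : Cube n → ℤˣ) (J : Finset (Fin n)) :
    ∑ i ∈ J, ∑ S : Finset (Fin n),
        (if S ∩ J = {i} then (1 / 4) ^ S.card * fourier (centered f) S ^ 2 else 0) ≤
      √(∑ i, influence f i ^ 2) * √(variance f) := by
  -- Correlation `0` averages out the coordinates of `J` other than `i`; correlation `1` leaves the
  -- rest untouched.
  set q : Fin n → Fin n → ℝ := fun i k => if k ∈ J.erase i then 0 else 1 with hq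
  set v : Fin n → Cube n → ℝ := fun i => noiseOp (q i) (laplacian i (centered f)) with hv
  have hfv : ∀ i ∈ J, ∀ S, fourier (v i) S =
      if S ∩ J = {i} then fourier (centered f) S else 0 := by
    intro i hi S
    have hiff : S ∩ J = {i} ↔ i ∈ S ∧ ∀ k ∈ S, k ∉ J.erase i := by
      constructor
      · intro h
        have h' : ∀ k, k ∈ S ∧ k ∈ J ↔ k = i := fun k => by
          rw [← Finset.mem_inter, h, Finset.mem_singleton]
        exact ⟨((h' i).2 rfl).1, fun k hk hkJ =>
          (Finset.mem_erase.1 hkJ).1 ((h' k).1 ⟨hk, (Finset.mem_erase.1 hkJ).2⟩)⟩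
      · rintro ⟨hiS, h⟩
        ext k
        simp only [Finset.mem_inter, Finset.mem_singleton]
        constructor
        · rintro ⟨hk, hkJ⟩
          by_contra hne
          exact h k hk (Finset.mem_erase.2 ⟨hne, hkJ⟩)
        · rintro rfl
          exact ⟨hiS, hi⟩
    rw [hv, fourier_noiseOp, fourier_laplacian]
    by_cases hiS : i ∈ S
    · by_cases hS : ∀ k ∈ S, k ∉ J.erase i
      · rw [if_pos hiS, if_pos (hiff.2 ⟨hiS, hS⟩), Finset.prod_eq_one, one_mul]
        exact fun k hk => if_neg (hS k hk)
      · rw [if_neg fun h => hS (hiff.1 h).2]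
        push Not at hS
        obtain ⟨k, hk, hkJ⟩ := hS
        have hz : q i k = 0 := if_pos hkJ
        rw [Finset.prod_eq_zero hk hz, zero_mul]
    · rw [if_neg hiS, if_neg fun h => hiS (hiff.1 h).1, mul_zero]
  have hterm : ∀ i ∈ J, ∑ S : Finset (Fin n),
      (if S ∩ J = {i} then (1 / 4) ^ S.card * fourier (centered f) S ^ 2 else 0) ≤
        influence f i * √(expect fun x => v i x ^ 2) := by
    intro i hi
    calc _ = expect fun x => noiseOp (fun _ => 1 / 2) (v i) x ^ 2 := by
          rw [parseval]
          refine Finset.sum_congr rfl fun S _ => ?_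
          rw [fourier_noiseOp, hfv i hi, Finset.prod_const, mul_pow, ← pow_mul,
            mul_comm S.card 2, pow_mul]
          split_ifs <;> norm_num
      _ ≤ _ := expect_noiseOp_sq_le _
      _ ≤ _ := by
          refine mul_le_mul_of_nonneg_right ?_ (Real.sqrt_nonneg _)
          rw [← expect_abs_laplacian]
          refine expect_abs_noiseOp_le (fun k => ?_) (fun k => ?_) _ <;>
            simp only [hq] <;> split_ifs <;> norm_num
  -- Each `S` meets `J` in at most one singleton, so it is counted at most once.
  have hsum : ∑ i ∈ J, (expect fun x => v i x ^ 2) ≤ variance f := by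
    calc ∑ i ∈ J, (expect fun x => v i x ^ 2)
        = ∑ i ∈ J, ∑ S : Finset (Fin n),
            if S ∩ J = {i} then fourier (centered f) S ^ 2 else 0 := by
          refine Finset.sum_congr rfl fun i hi => ?_
          rw [parseval]
          refine Finset.sum_congr rfl fun S _ => ?_
          rw [hfv i hi]
          split_ifs <;> norm_num
      _ ≤ variance f := by
          rw [Finset.sum_comm, variance_eq_sum]
          refine Finset.sum_le_sum fun S _ => ?_
          by_cases h : ∃ i, S ∩ J = {i}
          · obtain ⟨i, hi⟩ := h
            simp only [hi, Finset.singleton_inj, Finset.sum_ite_eq]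
            split_ifs
            · exact le_rfl
            · positivity
          · push Not at h
            simp only [h, if_false, Finset.sum_const_zero]
            positivity
  calc _ ≤ ∑ i ∈ J, influence f i * √(expect fun x => v i x ^ 2) := Finset.sum_le_sum hterm
    _ ≤ √(∑ i ∈ J, influence f i ^ 2) * √(∑ i ∈ J, √(expect fun x => v i x ^ 2) ^ 2) :=
        Real.sum_mul_le_sqrt_mul_sqrt _ _ _
    _ ≤ _ := by
        simp only [Real.sq_sqrt (expect_nonneg fun x => sq_nonneg (v _ x))]
        gcongr
        exact Finset.subset_univ _

/-- Adjoining `i` to any subset of the complement of `S` gives such a `J`. -/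
lemma two_pow_le_card_inter {S : Finset (Fin n)} {i : Fin n} (hi : i ∈ S) :
    2 ^ (n - S.card) ≤
      (Finset.univ.filter fun J : Finset (Fin n) => S ∩ J = {i}).card := by
  have hcard : 2 ^ (n - S.card) = (Sᶜ.powerset).card := by
    rw [Finset.card_powerset, Finset.card_compl, Fintype.card_fin]
  rw [hcard]
  refine Finset.card_le_card_of_injOn (insert i) ?_ ?_
  · intro J hJ
    have hJ' : ∀ k ∈ J, k ∉ S := fun k hk =>
      Finset.mem_compl.1 (Finset.mem_powerset.1 (Finset.mem_coe.1 hJ) hk)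
    simp only [Finset.coe_filter, Finset.mem_univ, true_and, Set.mem_ofPred_eq]
    ext k
    simp only [Finset.mem_inter, Finset.mem_insert, Finset.mem_singleton]
    constructor
    · rintro ⟨hk, rfl | hkJ⟩
      · rfl
      · exact absurd hk (hJ' k hkJ)
    · rintro rfl
      exact ⟨hi, Or.inl rfl⟩
  · intro J hJ J' hJ' h
    have aux : ∀ J ∈ (Sᶜ.powerset : Finset (Finset (Fin n))), i ∉ J := fun J hJ hiJ =>
      Finset.mem_compl.1 (Finset.mem_powerset.1 hJ hiJ) hi
    rw [← Finset.erase_insert (aux J hJ), ← Finset.erase_insert (aux J' hJ')]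
    exact congrArg (fun K => Finset.erase K i) h

/-- Sum the bound for fixed `J` over all `2^n` sets `J`. A nonempty `S` isolates a chosen element
for a proportion `2⁻¹ ^ |S|` of them, which turns `4⁻¹` into `8⁻¹` per coordinate. -/
lemma dampedWeight_le_influence (f : Cube n → ℤˣ) :
    dampedWeight f ≤ √(∑ i, influence f i ^ 2) * √(variance f) := by
  set a : Finset (Fin n) → ℝ := fun S => (1 / 4) ^ S.card * fourier (centered f) S ^ 2 with ha
  have ha0 : ∀ S, 0 ≤ a S := fun S => by positivity
  have hle : ∀ S : Finset (Fin n), 2 ^ n * ((1 / 8) ^ S.card * fourier (centered f) S ^ 2) ≤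
      ∑ J : Finset (Fin n), ∑ i ∈ J, if S ∩ J = {i} then a S else 0 := by
    intro S
    have hnn : ∀ J : Finset (Fin n), ∀ i ∈ J, (0 : ℝ) ≤ if S ∩ J = {i} then a S else 0 :=
      fun J i _ => by split_ifs; exacts [ha0 S, le_rfl]
    rcases S.eq_empty_or_nonempty with rfl | ⟨i, hi⟩
    · rw [fourier_centered_empty]
      refine le_of_eq_of_le (by simp) (Finset.sum_nonneg fun J _ => Finset.sum_nonneg (hnn J))
    · have hSn : S.card ≤ n := by simpa using S.card_le_univ
      calc 2 ^ n * ((1 / 8) ^ S.card * fourier (centered f) S ^ 2)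
          = (2 ^ (n - S.card) : ℕ) * a S := by
            have h2 : (2 : ℝ) ^ n = 2 ^ (n - S.card) * 2 ^ S.card := by
              rw [← pow_add, Nat.sub_add_cancel hSn]
            have h8 : (1 / 4 : ℝ) ^ S.card = 2 ^ S.card * (1 / 8) ^ S.card := by
              rw [← mul_pow]; norm_num
            simp only [ha]
            push_cast
            rw [h2, h8]; ring
        _ ≤ (Finset.univ.filter fun J : Finset (Fin n) => S ∩ J = {i}).card * a S := by
            refine mul_le_mul_of_nonneg_right ?_ (ha0 S)
            exact_mod_cast two_pow_le_card_inter hi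
        _ = ∑ J : Finset (Fin n), if S ∩ J = {i} then a S else 0 := by
            rw [← Finset.sum_filter, Finset.sum_const, nsmul_eq_mul]
        _ ≤ _ := by
            refine Finset.sum_le_sum fun J _ => ?_
            split_ifs with h
            · have hiJ : i ∈ J := by
                have : i ∈ S ∩ J := by rw [h]; exact Finset.mem_singleton_self i
                exact (Finset.mem_inter.1 this).2
              refine le_trans (le_of_eq ?_) (Finset.single_le_sum (hnn J) hiJ)
              rw [if_pos h]
            · exact Finset.sum_nonneg (hnn J)
  have h2n : (0 : ℝ) < 2 ^ n := by positivity
  refine le_of_mul_le_mul_left ?_ h2n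
  calc 2 ^ n * dampedWeight f
      ≤ ∑ S : Finset (Fin n), ∑ J : Finset (Fin n), ∑ i ∈ J,
          if S ∩ J = {i} then a S else 0 := by
        rw [dampedWeight, Finset.mul_sum]
        exact Finset.sum_le_sum fun S _ => hle S
    _ = ∑ J : Finset (Fin n), ∑ i ∈ J, ∑ S : Finset (Fin n),
          if S ∩ J = {i} then a S else 0 := by
        rw [Finset.sum_comm]
        exact Finset.sum_congr rfl fun J _ => Finset.sum_comm
    _ ≤ ∑ _J : Finset (Fin n), √(∑ i, influence f i ^ 2) * √(variance f) :=
        Finset.sum_le_sum fun J _ => sum_inter_eq_singleton_le f J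
    _ = _ := by simp

/-- At constant noise, the Fourier weight is bounded by the variance times a power of the sum of
the squared influences. -/
theorem dampedWeight_le (f : Cube n → ℤˣ) :
    dampedWeight f ≤ variance f * (∑ i, influence f i ^ 2) ^ (1 / 4 : ℝ) := by
  set W := ∑ i, influence f i ^ 2 with hW
  have hW0 : 0 ≤ W := Finset.sum_nonneg fun _ _ => sq_nonneg _
  have hV0 := variance_nonneg f
  refine abs_le_of_sq_le_sq' ?_ (by positivity) |>.2
  calc dampedWeight f ^ 2
      ≤ (variance f * √(variance f)) * (√W * √(variance f)) := by
        rw [sq]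
        exact mul_le_mul (dampedWeight_le_variance f) (dampedWeight_le_influence f)
          (dampedWeight_nonneg f) (by positivity)
    _ = variance f ^ 2 * √W := by
        linear_combination variance f * √W * Real.mul_self_sqrt hV0
    _ = (variance f * W ^ (1 / 4 : ℝ)) ^ 2 := by
        rw [mul_pow, ← Real.rpow_natCast (W ^ _), ← Real.rpow_mul hW0, Real.sqrt_eq_rpow]
        norm_num

/-! ### Interpolation between noise levels -/

lemma one_sub_pow_le {ε : ℝ} (h0 : 0 ≤ ε) (h1 : ε ≤ 1) (k : ℕ) :
    (1 - ε) ^ k ≤ ((1 / 8 : ℝ) ^ k) ^ (ε / 3) := by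
  -- The right side is `2^(-ε) ≥ 1 - ε log 2`, and `log 2 < 1`.
  have hle : 1 - ε ≤ (1 / 8 : ℝ) ^ (ε / 3) := by
    have h8 : (1 / 8 : ℝ) ^ (ε / 3) = Real.exp (-(Real.log 2 * ε)) := by
      rw [Real.rpow_def_of_pos (by norm_num), show (1 / 8 : ℝ) = (2 ^ 3)⁻¹ by norm_num,
        Real.log_inv, Real.log_pow]
      congr 1; push_cast; ring
    rw [h8]
    have := Real.add_one_le_exp (-(Real.log 2 * ε))
    nlinarith [Real.log_two_lt_d9]
  calc (1 - ε) ^ k ≤ ((1 / 8 : ℝ) ^ (ε / 3)) ^ k := pow_le_pow_left₀ (by linarith) hle k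
    _ = ((1 / 8 : ℝ) ^ k) ^ (ε / 3) := by
        rw [← Real.rpow_natCast, ← Real.rpow_mul (by norm_num), mul_comm, Real.rpow_mul (by norm_num),
          Real.rpow_natCast]

theorem noiseStability_le (f : Cube n → ℤˣ) {ε : ℝ} (h0 : 0 ≤ ε) (h1 : ε ≤ 1) :
    noiseStability ε f ≤ variance f * (∑ i, influence f i ^ 2) ^ (1 / 12 * ε) := by
  set W := ∑ i, influence f i ^ 2 with hW
  have hW0 : 0 ≤ W := Finset.sum_nonneg fun _ _ => sq_nonneg _
  have hV0 := variance_nonneg f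
  have hB := dampedWeight_le f
  rw [← hW] at hB
  rw [noiseStability_eq_sum]
  rcases hW0.eq_or_lt with hz | hpos
  -- For `W = 0` division by `D` is impossible, but all coefficients vanish; the right side is
  -- nonnegative even when it involves `0^0`.
  · have hB0 : dampedWeight f = 0 := by
      refine le_antisymm ?_ (dampedWeight_nonneg f)
      rwa [← hz, Real.zero_rpow (by norm_num), mul_zero] at hB
    have hc : ∀ S, fourier (centered f) S ^ 2 = 0 := by
      intro S
      have := (Finset.sum_eq_zero_iff_of_nonneg fun S _ => by positivity).1 hB0 S (Finset.mem_univ S)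
      exact (mul_eq_zero.1 this).resolve_left (by positivity)
    simp only [hc, mul_zero, Finset.sum_const_zero]
    positivity
  · set D := W ^ (1 / 4 : ℝ) with hD
    have hD0 : 0 < D := Real.rpow_pos_of_pos hpos _
    have hDW : D ^ (ε / 3) = W ^ (1 / 12 * ε) := by
      rw [hD, ← Real.rpow_mul hW0]; congr 1; ring
    -- Weighted AM-GM replaces a power of `(1/8)^k` by an affine function of it, so that the sum
    -- over `S` involves only the damped weight and the variance.
    have hterm : ∀ k : ℕ, (1 - ε) ^ k ≤
        D ^ (ε / 3) * (ε / 3 * ((1 / 8) ^ k / D) + (1 - ε / 3)) := by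
      intro k
      have hy := Real.geom_mean_le_arith_mean2_weighted (w₁ := ε / 3) (w₂ := 1 - ε / 3)
        (p₁ := (1 / 8) ^ k / D) (p₂ := 1) (by linarith) (by linarith) (by positivity) zero_le_one
        (by ring)
      rw [Real.one_rpow, mul_one, mul_one, Real.div_rpow (by positivity) hD0.le] at hy
      refine (one_sub_pow_le h0 h1 k).trans ?_
      rwa [div_le_iff₀' (by positivity)] at hy
    calc ∑ S : Finset (Fin n), (1 - ε) ^ S.card * fourier (centered f) S ^ 2
        ≤ ∑ S : Finset (Fin n), D ^ (ε / 3) *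
            (ε / 3 / D * ((1 / 8) ^ S.card * fourier (centered f) S ^ 2) +
              (1 - ε / 3) * fourier (centered f) S ^ 2) := by
          refine Finset.sum_le_sum fun S _ => ?_
          refine (mul_le_mul_of_nonneg_right (hterm S.card) (sq_nonneg _)).trans_eq ?_
          ring
      _ = D ^ (ε / 3) * (ε / 3 / D * dampedWeight f + (1 - ε / 3) * variance f) := by
          rw [← Finset.mul_sum, Finset.sum_add_distrib, ← Finset.mul_sum, ← Finset.mul_sum,
            ← variance_eq_sum, dampedWeight]
      _ ≤ D ^ (ε / 3) * (ε / 3 / D * (variance f * D) + (1 - ε / 3) * variance f) := by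
          gcongr
      _ = variance f * W ^ (1 / 12 * ε) := by
          rw [← hDW]; field_simp; ring

end BooleanCube

theorem mainTheorem4 :
    ∃ C c : ℝ, 0 < C ∧ 0 < c ∧
      ∀ (n : ℕ) (f : BooleanCube.Cube n → ℤˣ) (ε : ℝ), 0 ≤ ε → ε ≤ 1 →
        BooleanCube.noiseStability ε f ≤
          C * BooleanCube.variance f *
            (∑ i : Fin n, BooleanCube.influence f i ^ 2) ^ (c * ε) := by
  -- `1/12` is the exponent `1/4` at fixed noise times the `1/3` from `8 = 2^3`.
  refine ⟨1, 1 / 12, one_pos, by norm_num, fun n f ε h0 h1 => ?_⟩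
  rw [one_mul]
  exact BooleanCube.noiseStability_le f h0 h1
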